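/- All graphs are finite and simple, and $\log$ is to base $2$. For a graph $F$ and an integer $t\ge 2$, let $r(F,t)$ be the least $N$ such that every $N$-vertex graph containing no (not necessarily induced) copy of $F$ has an independent set of order $t$. Let $\mathcal{E}(F)$ be the set of all sequences $H=(H_1,\dots,H_k)$ of edge-disjoint bipartite subgraphs of $F$, each with at least one edge, such that the sets $E(H_i)$ partition $E(F)$ and $|V(H_i)\cap V(H_j)|\le 1$ for all $i<j$. For such $H$, let $J(H)$ be the bipartite graph with parts $[k]$ and $V(F)$ in which $i\in[k]$ is adjacent to every vertex of $V(H_i)$. Let $\mathcal{L}(F)=\{J(H): H\in\mathcal{E}(F)\}\cup\{C_4\}$. For positive integers $m\le n$ and $a\le b$, an $(m,n,a,b)$-graph is a bipartite graph with parts of orders $m$ and $n$ such that every vertex in the part of order $n$ has degree $a$ and every vertex in the part of order $m$ has degree $b$. It is $\mathcal{L}(F)$-free if it contains no copy of $C_4$ and, for every $H\in\mathcal{E}(F)$, no (not necessarily induced) copy of $J(H)$ with $[k]$ in the part of order $m$ and $V(F)$ in the part of order $n$. **Theorem.** There is an absolute constant $c>0$ such that the following holds. Let $F$ be a graph and let $a,b,m,n$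 be positive integers with $n\ge 2$ and $a\ge 2^{12}(\log n)^3$ such that there exists an $\mathcal{L}(F)$-free $(m,n,a,b)$-graph. If $t$ is equal to $2^8 n(\log n)^2/(ab)$, up to rounding to an integer (that is, $t$ is an integer with $|t-2^8n(\log n)^2/(ab)|<1$), then $$ r(F,t)\;\ge\; c\,\frac{bt}{\log n}. $$ -/

import Mathlib

/-- The independence version of the Ramsey number: `ramseyNumber F t` is the least `N` such that
every `F`-free graph on `N` vertices contains an independent set of order `t`
(for finite `F` such an `N` exists by Ramsey's theorem). -/
noncomputable def ramseyNumber {W : Type*} (F : SimpleGraph W) (t : ℕ) : ℕ :=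
  sInf {N : ℕ | ∀ G : SimpleGraph (Fin N), F.Free G → ∃ s : Finset (Fin N), G.IsNIndepSet t s}

/-- `H₁, …, H_k` is a sequence of edge-disjoint bipartite subgraphs of `F`, each with at least one
edge, whose edge sets partition the edge set of `F` and any two of which share at most one
vertex. -/
structure IsBipartiteDecomposition {W : Type*} (F : SimpleGraph W) {k : ℕ}
    (H : Fin k → F.Subgraph) : Prop where
  bipartite : ∀ i, (H i).coe.IsBipartite
  edgeSet_nonempty : ∀ i, (H i).edgeSet.Nonempty
  edgeSet_disjoint : ∀ i j, i ≠ j → Disjoint (H i).edgeSet (H j).edgeSet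
  iUnion_edgeSet : ⋃ i, (H i).edgeSet = F.edgeSet
  verts_inter : ∀ i j, i ≠ j → ((H i).verts ∩ (H j).verts).Subsingleton

/-- The bipartite graph `J(H)` with parts `[k]` and `V(F)` in which `i` is adjacent to every
vertex of `H i`. -/
def incidenceGraph {W : Type*} {F : SimpleGraph W} {k : ℕ} (H : Fin k → F.Subgraph) :
    SimpleGraph (Fin k ⊕ W) :=
  SimpleGraph.fromRel fun x y => ∃ i w, x = Sum.inl i ∧ y = Sum.inr w ∧ w ∈ (H i).verts

/-- `G` contains a copy of the bipartite graph `J` in which the first part of `J` lies in the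
first part of `G` and the second part of `J` lies in the second part of `G`. -/
def ContainsBipartite {A B U V : Type*} (J : SimpleGraph (A ⊕ B)) (G : SimpleGraph (U ⊕ V)) :
    Prop :=
  ∃ (f : A ↪ U) (g : B ↪ V), ∀ x y, J.Adj x y → G.Adj (Sum.map f g x) (Sum.map f g y)

/-- `G` is `𝓛(F)`-free, where `𝓛(F)` consists of the cycle `C₄` and of all the graphs `J(H)`,
for `H` a decomposition of `F` as above. -/
def IsLFree {W : Type*} (F : SimpleGraph W) {U V : Type*} (G : SimpleGraph (U ⊕ V)) : Prop :=
  (SimpleGraph.cycleGraph 4).Free G ∧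
    ∀ (k : ℕ) (H : Fin k → F.Subgraph), IsBipartiteDecomposition F H →
      ¬ ContainsBipartite (incidenceGraph H) G

/-- `G` is an `(m, n, a, b)`-graph: bipartite with parts of orders `m ≤ n`, all vertices in the
part of order `n` having degree `a` and all vertices in the part of order `m` having degree
`b ≥ a`. -/
structure IsMNABGraph (m n a b : ℕ) (G : SimpleGraph (Fin m ⊕ Fin n)) : Prop where
  bipartite : G ≤ completeBipartiteGraph (Fin m) (Fin n)
  m_le_n : m ≤ n
  a_le_b : a ≤ b
  degree_right : ∀ v : Fin n, (G.neighborSet (Sum.inr v)).ncard = a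
  degree_left : ∀ u : Fin m, (G.neighborSet (Sum.inl u)).ncard = b

/-! The neighbourhoods of the m left vertices are blocks in `Fin n` that meet pairwise in at most
one point, as `G` has no C₄. Two-colour each block at random and join differently coloured points
inside it. A copy of F would split along the blocks into bipartite pieces and so give a J(H) in `G`;
hence every colouring yields an F-free graph (`free_blockGraph_block`).

A union bound gives a colouring for which every X with a|X| ≥ 16m has minority classes of total
order at least a|X|/8 over the blocks (`exists_coloring_forall_minorityCard`). By Cauchy–Schwarz
such an X contains a vertex with at least a²|X|/(64m) neighbours in X. Kleitman–Winston counting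
(`card_indepSetsIn_le`) then bounds the number of independent t-sets by C(n,r)·C(R,t−r), with R ≈
16m/a = 16n/b and r ≈ t/log n. For N a small multiple of bt/log n, a random N-set contains fewer
than one of them on average, so some N-set spans an F-free graph without independent t-sets. -/

/-! ### Ramsey's theorem: the infimum is attained -/

theorem SimpleGraph.exists_isNClique_or_isNIndepSet (s t : ℕ) :
    ∃ N : ℕ, ∀ {V : Type} (G : SimpleGraph V) (S : Finset V), N ≤ S.card →
      (∃ T ⊆ S, G.IsNClique s T) ∨ ∃ T ⊆ S, G.IsNIndepSet t T := by
  classical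
  induction s generalizing t with
  | zero => exact ⟨0, fun G S _ => Or.inl ⟨∅, by simp, by simp [SimpleGraph.isNClique_iff]⟩⟩
  | succ s ihs =>
    induction t with
    | zero => exact ⟨0, fun G S _ => Or.inr ⟨∅, by simp, by simp [SimpleGraph.isNIndepSet_iff]⟩⟩
    | succ t iht =>
      obtain ⟨N₁, h₁⟩ := ihs (t + 1)
      obtain ⟨N₂, h₂⟩ := iht
      refine ⟨N₁ + N₂ + 1, fun {V} G S hS => ?_⟩
      obtain ⟨v, hv⟩ : S.Nonempty := Finset.card_pos.mp (by omega)
      have hcard := Finset.card_filter_add_card_filter_not (s := S.erase v) (fun w => G.Adj v w)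
      rw [Finset.card_erase_of_mem hv] at hcard
      have hsub : ∀ (p : V → Prop) [DecidablePred p], (S.erase v).filter p ⊆ S := fun p _ =>
        (Finset.filter_subset _ _).trans (Finset.erase_subset _ _)
      rcases le_or_gt N₁ ((S.erase v).filter fun w => G.Adj v w).card with h | h
      · rcases h₁ G _ h with ⟨T, hT, hT'⟩ | ⟨T, hT, hT'⟩
        · refine Or.inl ⟨insert v T, Finset.insert_subset hv (hT.trans (hsub _)),
            hT'.insert fun w hw => ?_⟩
          exact (Finset.mem_filter.mp (hT hw)).2
        · exact Or.inr ⟨T, hT.trans (hsub _), hT'⟩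
      · rcases h₂ G ((S.erase v).filter fun w => ¬ G.Adj v w) (by omega) with
          ⟨T, hT, hT'⟩ | ⟨T, hT, hT'⟩
        · exact Or.inl ⟨T, hT.trans (hsub _), hT'⟩
        · refine Or.inr ⟨insert v T, Finset.insert_subset hv (hT.trans (hsub _)), ?_⟩
          rw [← SimpleGraph.isNClique_compl] at hT' ⊢
          refine hT'.insert fun w hw => ?_
          have := Finset.mem_filter.mp (hT hw)
          exact (SimpleGraph.compl_adj _ _ _).mpr ⟨(Finset.ne_of_mem_erase this.1).symm, this.2⟩

/-- `sInf ∅ = 0` would make the definition meaningless; Ramsey's theorem excludes this, since a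
clique of order |W| contains F. -/
theorem ramseyNumber_spec {W : Type*} [Finite W] (F : SimpleGraph W) (t : ℕ) :
    ∀ G : SimpleGraph (Fin (ramseyNumber F t)), F.Free G →
      ∃ s : Finset (Fin (ramseyNumber F t)), G.IsNIndepSet t s := by
  have hne : {N : ℕ | ∀ G : SimpleGraph (Fin N), F.Free G →
      ∃ s : Finset (Fin N), G.IsNIndepSet t s}.Nonempty := by
    obtain ⟨N, hN⟩ := SimpleGraph.exists_isNClique_or_isNIndepSet (Nat.card W) t
    refine ⟨N, fun G hG => ?_⟩
    rcases hN G Finset.univ (by simp) with ⟨T, -, hT⟩ | ⟨T, -, hT⟩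
    · refine absurd ?_ hG
      have e : W ≃ T := (Finite.equivFin W).trans (T.equivFinOfCardEq hT.card_eq).symm
      refine ⟨⟨⟨fun w => (e w : Fin N), fun {x y} hxy => ?_⟩, fun x y hxy => ?_⟩⟩
      · exact hT.isClique (e x).2 (e y).2 fun h => hxy.ne (e.injective (Subtype.ext h))
      · exact e.injective (Subtype.ext hxy)
    · exact ⟨T, hT⟩
  exact Nat.sInf_mem hne

/-! ### Block graphs and F-freeness -/

/-- The union, over all blocks `B u`, of the complete bipartite graphs between the two colour
classes of the colouring `σ u` of `B u`. -/
def blockGraph {U V : Type*} (B : U → Finset V) (σ : U → V → Bool) : SimpleGraph V where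
  Adj v w := ∃ u, v ∈ B u ∧ w ∈ B u ∧ σ u v ≠ σ u w
  symm := ⟨fun _ _ ⟨u, hv, hw, h⟩ => ⟨u, hw, hv, h.symm⟩⟩
  loopless := ⟨fun _ ⟨_, _, _, h⟩ => h rfl⟩

/-- Any two blocks share at most one point. -/
def IsPartialLinearSpace {U V : Type*} (B : U → Finset V) : Prop :=
  ∀ ⦃u u' v v'⦄, v ∈ B u → v' ∈ B u → v ∈ B u' → v' ∈ B u' → v ≠ v' → u = u'

/-- Each edge of the copy lies in exactly one block, and `σ u` properly colours the piece in block
`u`. Two common vertices of two pieces would be two points in two blocks. -/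
theorem exists_decomposition_of_copy_blockGraph {W U V : Type*} [Finite U] {F : SimpleGraph W}
    {B : U → Finset V} (hB : IsPartialLinearSpace B) {σ : U → V → Bool}
    (g : SimpleGraph.Copy F (blockGraph B σ)) :
    ∃ (k : ℕ) (H : Fin k → F.Subgraph) (f : Fin k ↪ U), IsBipartiteDecomposition F H ∧
      ∀ i, ∀ w ∈ (H i).verts, g w ∈ B (f i) := by
  classical
  let P : U → W → W → Prop := fun u x y =>
    F.Adj x y ∧ g x ∈ B u ∧ g y ∈ B u ∧ σ u (g x) ≠ σ u (g y)
  have hPs : ∀ u x y, P u x y → P u y x := fun u x y h => ⟨h.1.symm, h.2.2.1, h.2.1, h.2.2.2.symm⟩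
  let H' : U → F.Subgraph := fun u =>
    { verts := {x | ∃ y, P u x y}
      Adj := P u
      adj_sub := fun h => h.1
      edge_vert := fun {x y} h => ⟨y, h⟩
      symm := ⟨hPs u⟩ }
  -- Only blocks that carry an edge are kept, because every piece must have one.
  let S : Set U := {u | ∃ x y, P u x y}
  let e : Fin (Nat.card S) ≃ S := (Finite.equivFin S).symm
  have heq : ∀ u u' x y, x ≠ y → g x ∈ B u → g y ∈ B u → g x ∈ B u' → g y ∈ B u' → u = u' :=
    fun u u' x y hxy h1 h2 h3 h4 => hB h1 h2 h3 h4 (fun h => hxy (g.injective h))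
  refine ⟨_, fun i => H' (e i), ⟨fun i => (e i : U), fun i j h => e.injective (Subtype.ext h)⟩,
    ⟨fun i => ?_, fun i => ?_, fun i j hij => ?_, ?_, fun i j hij => ?_⟩, ?_⟩
  · refine ⟨SimpleGraph.Coloring.mk
      (fun x => if σ (e i) (g x) then (0 : Fin 2) else 1) fun {x y} hxy => ?_⟩
    have h : P (e i) x y := hxy
    have := h.2.2.2
    cases h1 : σ (e i) (g x) <;> cases h2 : σ (e i) (g y) <;> simp_all
  · obtain ⟨x, y, h⟩ := (e i).2
    exact ⟨s(x, y), h⟩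
  · rw [Set.disjoint_left]
    intro z
    induction z using Sym2.ind with
    | _ x y =>
      intro (h : P (e i) x y) (h' : P (e j) x y)
      exact hij (e.injective (Subtype.ext
        (heq _ _ x y h.1.ne h.2.1 h.2.2.1 h'.2.1 h'.2.2.1)))
  · ext z
    induction z using Sym2.ind with
    | _ x y =>
      simp only [Set.mem_iUnion, SimpleGraph.Subgraph.mem_edgeSet, SimpleGraph.mem_edgeSet]
      constructor
      · rintro ⟨i, h⟩
        exact h.1
      · intro h
        obtain ⟨u, h1, h2, h3⟩ := g.toHom.map_adj h
        have hP : P u x y := ⟨h, h1, h2, h3⟩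
        refine ⟨e.symm ⟨u, x, y, hP⟩, ?_⟩
        change P (e (e.symm ⟨u, x, y, hP⟩)) x y
        rw [e.apply_symm_apply]
        exact hP
  · rintro x ⟨⟨y, hy⟩, y', hy'⟩ z ⟨⟨w, hw⟩, w', hw'⟩
    by_contra hxz
    exact hij (e.injective (Subtype.ext
      (heq _ _ x z hxz hy.2.1 hw.2.1 hy'.2.1 hw'.2.1)))
  · rintro i w ⟨y, h⟩
    exact h.2.1

/-- The set of neighbours, in the second part, of a vertex in the first part. -/
noncomputable def block {m n : ℕ} (G : SimpleGraph (Fin m ⊕ Fin n)) (u : Fin m) :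
    Finset (Fin n) := by
  classical exact Finset.univ.filter fun v => G.Adj (Sum.inl u) (Sum.inr v)

theorem mem_block {m n : ℕ} {G : SimpleGraph (Fin m ⊕ Fin n)} {u : Fin m} {v : Fin n} :
    v ∈ block G u ↔ G.Adj (Sum.inl u) (Sum.inr v) := by
  simp [block]

theorem isPartialLinearSpace_block {m n : ℕ} {G : SimpleGraph (Fin m ⊕ Fin n)}
    (hG : (SimpleGraph.cycleGraph 4).Free G) : IsPartialLinearSpace (block G) := by
  intro u u' v v' h1 h2 h3 h4 hv
  by_contra hu
  rw [mem_block] at h1 h2 h3 h4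
  refine hG ⟨⟨⟨![Sum.inl u, Sum.inr v, Sum.inl u', Sum.inr v'], fun {x y} hxy => ?_⟩, ?_⟩⟩
  · rw [SimpleGraph.cycleGraph_adj] at hxy
    fin_cases x <;> fin_cases y <;> first
      | exact absurd hxy (by decide)
      | simp [h1, h2, h3, h4, h1.symm, h2.symm, h3.symm, h4.symm]
  · intro x y hxy
    fin_cases x <;> fin_cases y <;> simp_all

theorem free_blockGraph_block {W : Type*} {F : SimpleGraph W} {m n : ℕ}
    {G : SimpleGraph (Fin m ⊕ Fin n)} (hG : IsLFree F G) (σ : Fin m → Fin n → Bool) :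
    F.Free (blockGraph (block G) σ) := by
  rintro ⟨g⟩
  obtain ⟨k, H, f, hH, hf⟩ := exists_decomposition_of_copy_blockGraph (isPartialLinearSpace_block hG.1) g
  refine hG.2 k H hH ⟨f, g.toEmbedding, fun x y hxy => ?_⟩
  rw [incidenceGraph, SimpleGraph.fromRel_adj] at hxy
  obtain ⟨-, ⟨i, w, rfl, rfl, hw⟩ | ⟨i, w, rfl, rfl, hw⟩⟩ := hxy
  · exact mem_block.mp (hf i w hw)
  · exact (mem_block.mp (hf i w hw)).symm

theorem card_block {m n a b : ℕ} {G : SimpleGraph (Fin m ⊕ Fin n)} (hG : IsMNABGraph m n a b G)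
    (u : Fin m) : (block G u).card = b := by
  rw [← hG.degree_left u, ← Set.ncard_coe_finset,
    ← Set.ncard_image_of_injective _ (Sum.inr_injective (α := Fin m) (β := Fin n))]
  congr 1
  ext x
  rcases x with x | x
  · simpa using fun h => by simpa using hG.bipartite h
  · simp [mem_block]

theorem card_filter_mem_block {m n a b : ℕ} {G : SimpleGraph (Fin m ⊕ Fin n)}
    (hG : IsMNABGraph m n a b G) (v : Fin n) :
    (Finset.univ.filter fun u => v ∈ block G u).card = a := by
  rw [← hG.degree_right v, ← Set.ncard_coe_finset,
    ← Set.ncard_image_of_injective _ (Sum.inl_injective (α := Fin m) (β := Fin n))]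
  congr 1
  ext x
  rcases x with x | x
  · simp [mem_block, G.adj_comm]
  · simpa using fun h => by simpa using hG.bipartite h

/-! ### Kleitman–Winston counting of independent sets -/

open Classical in
/-- The independent sets of order `s` contained in `X`. -/
noncomputable def indepSetsIn {V : Type*} (G : SimpleGraph V) (X : Finset V) (s : ℕ) :
    Finset (Finset V) :=
  (X.powersetCard s).filter fun T => G.IsIndepSet T

theorem mem_indepSetsIn {V : Type*} {G : SimpleGraph V} {X T : Finset V} {s : ℕ} :
    T ∈ indepSetsIn G X s ↔ T ⊆ X ∧ T.card = s ∧ G.IsIndepSet T := by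
  simp [indepSetsIn, Finset.mem_powersetCard, and_assoc]

open Classical in
-- Branch on a vertex v of high degree in X. Independent sets containing v avoid its neighbours,
-- which shrinks X by a factor e^(-β) and uses up one of the r choices; the others lie in X − v.
-- Pascal's rule adds the two branches. `hX` is the invariant that r choices suffice to reach order
-- R.
theorem card_indepSetsIn_le {V : Type*} (G : SimpleGraph V) (R : ℕ) (β : ℝ)
    (hdeg : ∀ X : Finset V, R < X.card →
      ∃ v ∈ X, β * X.card ≤ ((X.filter fun w => G.Adj v w).card : ℝ))
    (X : Finset V) (r s : ℕ) (hrs : r ≤ s) (hX : X.card * Real.exp (-(β * r)) ≤ R) :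
    (indepSetsIn G X s).card ≤ X.card.choose r * R.choose (s - r) := by
  induction X using Finset.strongInduction generalizing r s with
  | H X ih =>
    rcases le_or_gt X.card R with hXR | hXR
    · calc (indepSetsIn G X s).card ≤ (X.powersetCard s).card := Finset.card_filter_le _ _
        _ = X.card.choose s := Finset.card_powersetCard _ _
        _ ≤ X.card.choose s * s.choose r := Nat.le_mul_of_pos_right _ (Nat.choose_pos hrs)
        _ = X.card.choose r * (X.card - r).choose (s - r) := Nat.choose_mul hrs
        _ ≤ _ := Nat.mul_le_mul_left _ (Nat.choose_le_choose _ (by omega))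
    · obtain ⟨v, hv, hd⟩ := hdeg X hXR
      obtain _ | r := r
      -- With r = 0, `hX` reads |X| ≤ R, contrary to `hXR`.
      · simp at hX
        omega
      obtain _ | s := s
      · omega
      let Y := (X.erase v).filter fun w => ¬ G.Adj v w
      have hYX : Y ⊆ X.erase v := Finset.filter_subset _ _
      have hXv : X.erase v ⊂ X := Finset.erase_ssubset hv
      have hcover : indepSetsIn G X (s + 1) ⊆
          indepSetsIn G (X.erase v) (s + 1) ∪ (indepSetsIn G Y s).image (insert v) := by
        intro T hT
        obtain ⟨h1, h2, h3⟩ := mem_indepSetsIn.mp hT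
        by_cases hvT : v ∈ T
        · refine Finset.mem_union_right _ (Finset.mem_image.mpr ⟨T.erase v, ?_,
            Finset.insert_erase hvT⟩)
          refine mem_indepSetsIn.mpr ⟨fun w hw => ?_, ?_, h3.mono (by simp)⟩
          · have hw' := Finset.mem_erase.mp hw
            exact Finset.mem_filter.mpr ⟨Finset.mem_erase.mpr ⟨hw'.1, h1 hw'.2⟩,
              h3 hvT hw'.2 hw'.1.symm⟩
          · rw [Finset.card_erase_of_mem hvT, h2]
            rfl
        · exact Finset.mem_union_left _ (mem_indepSetsIn.mpr
            ⟨Finset.subset_erase.mpr ⟨h1, hvT⟩, h2, h3⟩)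
      have hYcard : (Y.card : ℝ) + (X.filter fun w => G.Adj v w).card ≤ X.card := by
        have h : Y.card + (X.filter fun w => G.Adj v w).card ≤ X.card := by
          rw [← Finset.card_filter_add_card_filter_not (s := X) (fun w => G.Adj v w), add_comm]
          exact Nat.add_le_add_left (Finset.card_le_card
            (Finset.filter_subset_filter _ (Finset.erase_subset _ _))) _
        exact_mod_cast h
      have hY : (Y.card : ℝ) * Real.exp (-(β * r)) ≤ R := by
        have h1 : (Y.card : ℝ) ≤ X.card * Real.exp (-β) := by
          have := Real.add_one_le_exp (-β)
          nlinarith [Nat.cast_nonneg (α := ℝ) X.card]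
        calc (Y.card : ℝ) * Real.exp (-(β * r))
            ≤ X.card * Real.exp (-β) * Real.exp (-(β * r)) :=
              mul_le_mul_of_nonneg_right h1 (Real.exp_pos _).le
          _ = X.card * Real.exp (-(β * (r + 1 : ℕ))) := by
              rw [mul_assoc, ← Real.exp_add]
              push_cast
              ring_nf
          _ ≤ R := hX
      have hE : ((X.erase v).card : ℝ) * Real.exp (-(β * (r + 1 : ℕ))) ≤ R :=
        le_trans (mul_le_mul_of_nonneg_right
          (by exact_mod_cast Finset.card_le_card hXv.subset) (Real.exp_pos _).le) hX
      have i1 := ih _ hXv (r + 1) (s + 1) hrs hE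
      have i2 := ih Y (Finset.ssubset_of_subset_of_ssubset hYX hXv) r s (by omega) hY
      have hc : (X.erase v).card + 1 = X.card := Finset.card_erase_add_one hv
      have hYc : Y.card.choose r ≤ (X.erase v).card.choose r :=
        Nat.choose_le_choose _ (Finset.card_le_card hYX)
      rw [Nat.add_sub_add_right] at i1 ⊢
      calc (indepSetsIn G X (s + 1)).card
          ≤ (indepSetsIn G (X.erase v) (s + 1)).card + (indepSetsIn G Y s).card :=
            (Finset.card_le_card hcover).trans ((Finset.card_union_le _ _).trans
              (Nat.add_le_add_left Finset.card_image_le _))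
        _ ≤ (X.erase v).card.choose (r + 1) * R.choose (s - r) +
              (X.erase v).card.choose r * R.choose (s - r) :=
            Nat.add_le_add i1 (i2.trans (Nat.mul_le_mul_right _ hYc))
        _ = X.card.choose (r + 1) * R.choose (s - r) := by
            rw [← hc, Nat.choose_succ_succ']
            ring

/-! ### Sampling N vertices -/

/-- If independent sets of order `t` are few, then some `N` vertices contain none of them. -/
theorem exists_card_eq_and_forall_not_subset {V : Type*} [Fintype V] (I : Finset (Finset V))
    {N t : ℕ} (hI : ∀ T ∈ I, T.card = t) (hN : N ≤ Fintype.card V)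
    (h : I.card * N.choose t < (Fintype.card V).choose t) :
    ∃ S : Finset V, S.card = N ∧ ∀ T ∈ I, ¬ T ⊆ S := by
  classical
  rcases lt_or_ge N t with hNt | htN
  · obtain ⟨S, -, hS⟩ := Finset.exists_subset_card_eq (s := (Finset.univ : Finset V)) hN
    refine ⟨S, hS, fun T hT hTS => ?_⟩
    have := Finset.card_le_card hTS
    have := hI T hT
    omega
  -- Otherwise the N-sets are covered by the C(n−t, N−t) extensions of each T ∈ I; C(n,N)·C(N,t) =
  -- C(n,t)·C(n−t,N−t) then contradicts `h`.
  by_contra! hcon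
  have hcover : (Finset.univ : Finset V).powersetCard N ⊆
      I.biUnion fun T => ((Finset.univ \ T).powersetCard (N - t)).image (T ∪ ·) := by
    intro S hS
    obtain ⟨-, hS⟩ := Finset.mem_powersetCard.mp hS
    obtain ⟨T, hT, hTS⟩ := hcon S hS
    refine Finset.mem_biUnion.mpr ⟨T, hT, Finset.mem_image.mpr ⟨S \ T, ?_, ?_⟩⟩
    · refine Finset.mem_powersetCard.mpr ⟨Finset.sdiff_subset_sdiff (Finset.subset_univ _) le_rfl, ?_⟩
      rw [Finset.card_sdiff_of_subset hTS, hS, hI T hT]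
    · exact Finset.union_sdiff_of_subset hTS
  have h1 : (Fintype.card V).choose N ≤ I.card * (Fintype.card V - t).choose (N - t) := by
    calc (Fintype.card V).choose N = ((Finset.univ : Finset V).powersetCard N).card := by simp
      _ ≤ _ := Finset.card_le_card hcover
      _ ≤ I.card * (Fintype.card V - t).choose (N - t) := by
        refine Finset.card_biUnion_le_card_mul _ _ _ fun T hT => ?_
        refine Finset.card_image_le.trans ?_
        rw [Finset.card_powersetCard, Finset.card_sdiff_of_subset (Finset.subset_univ _), hI T hT,
          Finset.card_univ]
  have h2 := Nat.choose_mul (n := Fintype.card V) htN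
  have h3 : 0 < (Fintype.card V - t).choose (N - t) := Nat.choose_pos (by omega)
  have h4 : (Fintype.card V).choose t * (Fintype.card V - t).choose (N - t) ≤
      I.card * N.choose t * (Fintype.card V - t).choose (N - t) := by
    rw [← h2]
    calc _ ≤ I.card * (Fintype.card V - t).choose (N - t) * N.choose t :=
          Nat.mul_le_mul_right _ h1
      _ = _ := by ring
  exact absurd (Nat.le_of_mul_le_mul_right h4 h3) (by omega)

/-- A graph with few independent sets of order `t` witnesses a lower bound on the Ramsey number. -/
theorem lt_ramseyNumber {W : Type*} [Finite W] {F : SimpleGraph W} {n N t : ℕ}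
    {G : SimpleGraph (Fin n)} (hF : F.Free G) (hN : N ≤ n)
    (h : (indepSetsIn G Finset.univ t).card * N.choose t < n.choose t) :
    N < ramseyNumber F t := by
  obtain ⟨S, hS, hST⟩ := exists_card_eq_and_forall_not_subset (indepSetsIn G Finset.univ t)
    (N := N) (t := t) (fun T hT => (mem_indepSetsIn.mp hT).2.1) (by simpa using hN) (by simpa using h)
  by_contra! hle
  let e : Fin (ramseyNumber F t) ↪ Fin n :=
    (Fin.castLEEmb hle).trans ((S.equivFinOfCardEq hS).symm.toEmbedding.trans
      (Function.Embedding.subtype _))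
  have he : ∀ i, e i ∈ S := fun i => ((S.equivFinOfCardEq hS).symm (Fin.castLE hle i)).2
  obtain ⟨T, hT⟩ := ramseyNumber_spec F t (G.comap e) fun hc =>
    hF (hc.trans ⟨(SimpleGraph.Embedding.comap e G).toCopy⟩)
  refine hST (T.map e) (mem_indepSetsIn.mpr ⟨Finset.subset_univ _, ?_, ?_⟩) fun x hx => ?_
  · rw [Finset.card_map, hT.card_eq]
  · rintro x hx y hy hxy
    simp only [Finset.coe_map, Set.mem_image, Finset.mem_coe] at hx hy
    obtain ⟨i, hi, rfl⟩ := hx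
    obtain ⟨j, hj, rfl⟩ := hy
    exact hT.isIndepSet hi hj (fun h => hxy (congrArg e h))
  · obtain ⟨i, -, rfl⟩ := Finset.mem_map.mp hx
    exact he i

/-! ### Random colourings of the blocks -/

/-- The size of the smaller colour class of the colouring `τ` on `Y`. -/
def minorityCard {V : Type*} (Y : Finset V) (τ : V → Bool) : ℕ :=
  min (Y.filter fun v => τ v = true).card (Y.filter fun v => τ v = false).card

/-- The sum factors over vertices: a point of Y contributes 1 + 1/2 = 2·(3/4), any other point 2. -/
theorem sum_half_pow_card_filter {V : Type*} [Fintype V] [DecidableEq V] (Y : Finset V) (c : Bool) :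
    ∑ τ : V → Bool, (1 / 2 : ℝ) ^ (Y.filter fun v => τ v = c).card =
      2 ^ Fintype.card V * (3 / 4 : ℝ) ^ Y.card := by
  have h1 : ∀ τ : V → Bool, (1 / 2 : ℝ) ^ (Y.filter fun v => τ v = c).card =
      ∏ v, (if v ∈ Y ∧ τ v = c then (1 / 2 : ℝ) else 1) := by
    intro τ
    rw [Finset.prod_ite, Finset.prod_const, Finset.prod_const_one, mul_one]
    congr 2
    ext v
    simp
  have h2 := Finset.prod_univ_sum (fun _ : V => (Finset.univ : Finset Bool))
    (fun v x => if v ∈ Y ∧ x = c then (1 / 2 : ℝ) else 1)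
  rw [Fintype.piFinset_univ] at h2
  simp_rw [h1]
  rw [← h2]
  have h3 : ∀ v, ∑ x : Bool, (if v ∈ Y ∧ x = c then (1 / 2 : ℝ) else 1) =
      2 * if v ∈ Y then 3 / 4 else 1 := by
    intro v
    by_cases hv : v ∈ Y <;> cases c <;> simp [hv] <;> norm_num
  simp_rw [h3]
  rw [Finset.prod_mul_distrib, Finset.prod_const, Finset.card_univ, Finset.prod_ite,
    Finset.prod_const, Finset.prod_const_one, mul_one]
  congr 3
  ext v
  simp

theorem sum_half_pow_minorityCard_le {V : Type*} [Fintype V] [DecidableEq V] (Y : Finset V) :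
    ∑ τ : V → Bool, (1 / 2 : ℝ) ^ minorityCard Y τ ≤
      2 * (2 ^ Fintype.card V * (3 / 4 : ℝ) ^ Y.card) := by
  rw [two_mul]
  nth_rewrite 1 [← sum_half_pow_card_filter Y true]
  rw [← sum_half_pow_card_filter Y false, ← Finset.sum_add_distrib]
  refine Finset.sum_le_sum fun τ _ => ?_
  rcases min_choice (Y.filter fun v => τ v = true).card (Y.filter fun v => τ v = false).card
    with h | h <;> rw [minorityCard, h]
  · exact le_add_of_nonneg_right (by positivity)
  · exact le_add_of_nonneg_left (by positivity)

theorem sum_half_pow_sum_minorityCard_le {U V : Type*} [Fintype U] [Fintype V] [DecidableEq U]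
    [DecidableEq V] (Y : U → Finset V) :
    ∑ σ : U → V → Bool, (1 / 2 : ℝ) ^ ∑ u, minorityCard (Y u) (σ u) ≤
      2 ^ Fintype.card U * Fintype.card (U → V → Bool) * (3 / 4 : ℝ) ^ ∑ u, (Y u).card := by
  have h := Finset.prod_univ_sum (fun _ : U => (Finset.univ : Finset (V → Bool)))
    (fun u τ => (1 / 2 : ℝ) ^ minorityCard (Y u) τ)
  rw [Fintype.piFinset_univ] at h
  simp_rw [← Finset.prod_pow_eq_pow_sum]
  rw [← h]
  refine (Finset.prod_le_prod (fun u _ => Finset.sum_nonneg fun τ _ => by positivity)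
    fun u _ => sum_half_pow_minorityCard_le (Y u)).trans (le_of_eq ?_)
  rw [Finset.prod_mul_distrib, Finset.prod_mul_distrib]
  simp [mul_assoc]

/-- Markov's inequality for 2^(−sum): as (3/4)^8 ≤ 1/8, the proportion of bad colourings is at most
2^D · 2^D · 8^(−D) = 2^(−D). -/
theorem card_filter_sum_minorityCard_le {U V : Type*} [Fintype U] [Fintype V] [DecidableEq U]
    [DecidableEq V] (Y : U → Finset V) (D : ℕ) (hD : 8 * D ≤ ∑ u, (Y u).card)
    (hU : Fintype.card U ≤ D) :
    ((Finset.univ.filter fun σ : U → V → Bool =>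
      ∑ u, minorityCard (Y u) (σ u) ≤ D).card : ℝ) ≤
        Fintype.card (U → V → Bool) * (1 / 2 : ℝ) ^ D := by
  set T : ℝ := ((Fintype.card (U → V → Bool) : ℕ) : ℝ) with hT
  have hT0 : 0 ≤ T := Nat.cast_nonneg _
  set bad := Finset.univ.filter fun σ : U → V → Bool => ∑ u, minorityCard (Y u) (σ u) ≤ D
  have h1 : (bad.card : ℝ) * (1 / 2) ^ D ≤ 2 ^ D * T * (1 / 8) ^ D := by
    calc (bad.card : ℝ) * (1 / 2) ^ D = ∑ σ ∈ bad, (1 / 2 : ℝ) ^ D := by simp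
      _ ≤ ∑ σ ∈ bad, (1 / 2 : ℝ) ^ ∑ u, minorityCard (Y u) (σ u) := by
        refine Finset.sum_le_sum fun σ hσ => ?_
        exact pow_le_pow_of_le_one (by norm_num) (by norm_num) (Finset.mem_filter.mp hσ).2
      _ ≤ ∑ σ : U → V → Bool, (1 / 2 : ℝ) ^ ∑ u, minorityCard (Y u) (σ u) :=
        Finset.sum_le_sum_of_subset_of_nonneg (Finset.subset_univ _) fun _ _ _ => by positivity
      _ ≤ 2 ^ Fintype.card U * T * (3 / 4 : ℝ) ^ ∑ u, (Y u).card :=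
        sum_half_pow_sum_minorityCard_le Y
      _ ≤ 2 ^ D * T * (1 / 8) ^ D := by
        gcongr
        · norm_num
        · calc (3 / 4 : ℝ) ^ ∑ u, (Y u).card ≤ (3 / 4 : ℝ) ^ (8 * D) :=
              pow_le_pow_of_le_one (by norm_num) (by norm_num) hD
            _ = ((3 / 4 : ℝ) ^ 8) ^ D := pow_mul _ _ _
            _ ≤ (1 / 8) ^ D := pow_le_pow_left₀ (by norm_num) (by norm_num) _
  have h2 : (2 : ℝ) ^ D * T * (1 / 8) ^ D = T * (1 / 2) ^ D * (1 / 2) ^ D := by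
    have : (2 : ℝ) ^ D * (1 / 8) ^ D = (1 / 2) ^ D * (1 / 2) ^ D := by
      rw [← mul_pow, ← mul_pow]
      norm_num
    linear_combination T * this
  rw [h2] at h1
  exact le_of_mul_le_mul_right h1 (by positivity)

theorem sum_card_inter_block {U V : Type*} [Fintype U] [DecidableEq V] {B : U → Finset V} {a : ℕ}
    (ha : ∀ v, (Finset.univ.filter fun u => v ∈ B u).card = a) (X : Finset V) :
    ∑ u, (X ∩ B u).card = a * X.card := by
  have h : ∀ u, (X ∩ B u).card = ∑ v ∈ X, if v ∈ B u then 1 else 0 := fun u => by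
    rw [← Finset.card_filter, Finset.filter_mem_eq_inter]
  simp_rw [h]
  rw [Finset.sum_comm]
  simp_rw [← Finset.card_filter, ha]
  simp [mul_comm]

theorem one_add_pow_lt_two {n : ℕ} {δ : ℝ} (hδ : 0 ≤ δ) (h : n * δ ≤ 1 / 2) :
    (1 + δ) ^ n < 2 := by
  have h1 : (1 + δ) ^ n ≤ Real.exp (1 / 2) := by
    calc (1 + δ) ^ n ≤ Real.exp δ ^ n :=
          pow_le_pow_left₀ (by positivity) (by linarith [Real.add_one_le_exp δ]) _
      _ = Real.exp (n * δ) := (Real.exp_nat_mul δ n).symm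
      _ ≤ _ := Real.exp_le_exp.mpr h
  have h2 : Real.exp (1 / 2) ^ 2 = Real.exp 1 := by
    rw [← Real.exp_nat_mul]
    norm_num
  have h3 := Real.exp_one_lt_d9
  nlinarith [Real.exp_pos (1 / 2)]

/-- Union bound: X fails with probability at most δ^|X|, where δ = 2^(−2K), and the nonempty X
contribute at most (1 + δ)^|V| − 1 < 1 in total. -/
theorem exists_coloring_forall_minorityCard {U V : Type*} [Fintype U] [Nonempty U] [Fintype V]
    [DecidableEq V] {B : U → Finset V} {a K : ℕ}
    (ha : ∀ v, (Finset.univ.filter fun u => v ∈ B u).card = a) (hK : 0 < K)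
    (hV : Fintype.card V ≤ 2 ^ K) (haK : 16 * K ≤ a) :
    ∃ σ : U → V → Bool, ∀ X : Finset V, 16 * Fintype.card U ≤ a * X.card →
      a * X.card ≤ 8 * ∑ u, minorityCard (X ∩ B u) (σ u) := by
  classical
  by_contra! hcon
  set T : ℝ := ((Fintype.card (U → V → Bool) : ℕ) : ℝ) with hT
  have hTpos : 0 < T := by
    rw [hT]
    exact_mod_cast Fintype.card_pos
  set δ : ℝ := (1 / 2) ^ (2 * K) with hδ
  let big : Finset (Finset V) := Finset.univ.filter fun X => 16 * Fintype.card U ≤ a * X.card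
  let bad : Finset V → Finset (U → V → Bool) := fun X => Finset.univ.filter fun σ =>
    ∑ u, minorityCard (X ∩ B u) (σ u) ≤ a * X.card / 8
  have hcover : (Finset.univ : Finset (U → V → Bool)) ⊆ big.biUnion bad := by
    intro σ _
    obtain ⟨X, hX, hX'⟩ := hcon σ
    refine Finset.mem_biUnion.mpr ⟨X, by simpa [big] using hX, ?_⟩
    simp only [bad, Finset.mem_filter, Finset.mem_univ, true_and]
    omega
  have hbad : ∀ X ∈ big, ((bad X).card : ℝ) ≤ T * δ ^ X.card := by
    intro X hX
    have hX : 16 * Fintype.card U ≤ a * X.card := by simpa [big] using hX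
    refine (card_filter_sum_minorityCard_le (fun u => X ∩ B u) (a * X.card / 8) ?_ (by omega)).trans
      ?_
    · rw [sum_card_inter_block ha]
      omega
    · rw [hδ, ← pow_mul]
      refine mul_le_mul_of_nonneg_left (pow_le_pow_of_le_one (by norm_num) (by norm_num) ?_) hTpos.le
      rw [Nat.le_div_iff_mul_le (by norm_num)]
      calc 2 * K * X.card * 8 = 16 * K * X.card := by ring
        _ ≤ a * X.card := Nat.mul_le_mul_right _ haK
  have hsum : ∑ X : Finset V, δ ^ X.card = (1 + δ) ^ Fintype.card V := by
    simpa [add_comm] using Fintype.sum_pow_mul_eq_add_pow V δ 1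
  have hempty : (∅ : Finset V) ∉ big := by
    simp [big, Fintype.card_ne_zero]
  have hbig : ∑ X ∈ big, δ ^ X.card ≤ (1 + δ) ^ Fintype.card V - 1 := by
    rw [le_sub_iff_add_le, add_comm, ← hsum]
    have := Finset.sum_insert (f := fun X : Finset V => δ ^ X.card) hempty
    simp only [Finset.card_empty, pow_zero] at this
    rw [← this]
    exact Finset.sum_le_sum_of_subset_of_nonneg (Finset.subset_univ _) fun _ _ _ => by positivity
  have hlt : (1 + δ) ^ Fintype.card V < 2 := by
    refine one_add_pow_lt_two (by positivity) ?_
    have h1 : (Fintype.card V : ℝ) ≤ 2 ^ K := by exact_mod_cast hV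
    have h2 : (1 / 2 : ℝ) ^ K ≤ 1 / 2 := by
      simpa using pow_le_pow_of_le_one (a := (1 / 2 : ℝ)) (by norm_num) (by norm_num) hK
    calc (Fintype.card V : ℝ) * δ ≤ 2 ^ K * δ := by gcongr
      _ = (2 * (1 / 2)) ^ K * (1 / 2) ^ K := by
        rw [hδ, two_mul K, pow_add, mul_pow]
        ring
      _ ≤ 1 / 2 := by simpa using h2
  have hle : T ≤ T * ((1 + δ) ^ Fintype.card V - 1) := by
    calc T = ((Finset.univ : Finset (U → V → Bool)).card : ℝ) := by rw [hT, Finset.card_univ]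
      _ ≤ ((big.biUnion bad).card : ℝ) := by exact_mod_cast Finset.card_le_card hcover
      _ ≤ ∑ X ∈ big, ((bad X).card : ℝ) := by exact_mod_cast Finset.card_biUnion_le
      _ ≤ ∑ X ∈ big, T * δ ^ X.card := Finset.sum_le_sum hbad
      _ ≤ _ := by
        rw [← Finset.mul_sum]
        exact mul_le_mul_of_nonneg_left hbig hTpos.le
  nlinarith

/-! ### From minority classes to degrees -/

open Classical in
-- By linearity no pair of points lies in two blocks, so the bichromatic pairs of different blocks
-- are distinct edges.
theorem sum_card_mul_card_le_sum_degree {U V : Type*} [Fintype U]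
    {B : U → Finset V} (hB : IsPartialLinearSpace B) (σ : U → V → Bool) (X : Finset V) :
    ∑ u, ((X ∩ B u).filter fun v => σ u v = true).card *
        ((X ∩ B u).filter fun v => σ u v = false).card ≤
      ∑ v ∈ X, (X.filter fun w => (blockGraph B σ).Adj v w).card := by
  let E : U → Finset (V × V) := fun u =>
    ((X ∩ B u).filter fun v => σ u v = true) ×ˢ ((X ∩ B u).filter fun v => σ u v = false)
  have hE : ∀ u p, p ∈ E u ↔ ((p.1 ∈ X ∧ p.1 ∈ B u) ∧ σ u p.1 = true) ∧
      (p.2 ∈ X ∧ p.2 ∈ B u) ∧ σ u p.2 = false := fun u p => by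
    simp only [E, Finset.mem_product, Finset.mem_filter, Finset.mem_inter]
  have hdisj : ∀ u ∈ (Finset.univ : Finset U), ∀ u' ∈ (Finset.univ : Finset U), u ≠ u' →
      Disjoint (E u) (E u') := by
    intro u _ u' _ huu
    rw [Finset.disjoint_left]
    intro p hp hp'
    rw [hE] at hp hp'
    refine huu (hB hp.1.1.2 hp.2.1.2 hp'.1.1.2 hp'.2.1.2 fun h => ?_)
    have h1 := hp.1.2
    rw [h, hp.2.2] at h1
    exact Bool.false_ne_true h1
  have hsub : Finset.univ.biUnion E ⊆ (X ×ˢ X).filter fun p => (blockGraph B σ).Adj p.1 p.2 := by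
    intro p hp
    obtain ⟨u, -, hp⟩ := Finset.mem_biUnion.mp hp
    rw [hE] at hp
    refine Finset.mem_filter.mpr ⟨Finset.mem_product.mpr ⟨hp.1.1.1, hp.2.1.1⟩,
      u, hp.1.1.2, hp.2.1.2, ?_⟩
    rw [hp.1.2, hp.2.2]
    exact Bool.false_ne_true.symm
  calc ∑ u, ((X ∩ B u).filter fun v => σ u v = true).card *
        ((X ∩ B u).filter fun v => σ u v = false).card = ∑ u, (E u).card := by
        simp [E, Finset.card_product]
    _ = (Finset.univ.biUnion E).card := (Finset.card_biUnion hdisj).symm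
    _ ≤ _ := Finset.card_le_card hsub
    _ = ∑ v ∈ X, (X.filter fun w => (blockGraph B σ).Adj v w).card := by
        simp only [Finset.card_filter, Finset.sum_product]

open Classical in
theorem exists_le_degree_of_le_sum_minorityCard {U V : Type*} [Fintype U] [Nonempty U]
    {B : U → Finset V} (hB : IsPartialLinearSpace B) (σ : U → V → Bool) {X : Finset V} (hX : X.Nonempty)
    {a : ℕ} (h : a * X.card ≤ 8 * ∑ u, minorityCard (X ∩ B u) (σ u)) :
    ∃ v ∈ X, (a : ℝ) ^ 2 / (64 * Fintype.card U) * X.card ≤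
      ((X.filter fun w => (blockGraph B σ).Adj v w).card : ℝ) := by
  refine Finset.exists_le_of_sum_le hX ?_
  have hm : (0 : ℝ) < Fintype.card U := by exact_mod_cast Fintype.card_pos
  have hdeg : (∑ u, (minorityCard (X ∩ B u) (σ u) : ℝ) ^ 2) ≤
      ∑ v ∈ X, ((X.filter fun w => (blockGraph B σ).Adj v w).card : ℝ) := by
    have h1 : ∑ u, minorityCard (X ∩ B u) (σ u) ^ 2 ≤
        ∑ v ∈ X, (X.filter fun w => (blockGraph B σ).Adj v w).card := by
      refine le_trans (Finset.sum_le_sum fun u _ => ?_) (sum_card_mul_card_le_sum_degree hB σ X)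
      rw [sq]
      exact Nat.mul_le_mul (Nat.min_le_left _ _) (Nat.min_le_right _ _)
    exact_mod_cast h1
  have hcs := sq_sum_le_card_mul_sum_sq (s := Finset.univ)
    (f := fun u => (minorityCard (X ∩ B u) (σ u) : ℝ))
  rw [Finset.card_univ] at hcs
  have h' : (a : ℝ) * X.card ≤ 8 * ∑ u, (minorityCard (X ∩ B u) (σ u) : ℝ) := by exact_mod_cast h
  refine le_trans ?_ hdeg
  rw [Finset.sum_const, nsmul_eq_mul]
  have h2 : ((a : ℝ) * X.card) ^ 2 ≤ (8 * ∑ u, (minorityCard (X ∩ B u) (σ u) : ℝ)) ^ 2 :=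
    pow_le_pow_left₀ (by positivity) h' 2
  have h3 : (X.card : ℝ) * ((a : ℝ) ^ 2 / (64 * Fintype.card U) * X.card) =
      ((a : ℝ) * X.card) ^ 2 / (64 * Fintype.card U) := by ring
  rw [h3, div_le_iff₀ (by positivity)]
  nlinarith

theorem mul_pred_card_block_le {U V : Type*} [Fintype U] [Fintype V] [DecidableEq V]
    {B : U → Finset V} (hB : IsPartialLinearSpace B) {a b : ℕ} (hb : ∀ u, (B u).card = b) (v : V)
    (ha : (Finset.univ.filter fun u => v ∈ B u).card = a) :
    a * (b - 1) ≤ Fintype.card V := by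
  classical
  have hdisj : ∀ u ∈ Finset.univ.filter fun u => v ∈ B u,
      ∀ u' ∈ Finset.univ.filter fun u => v ∈ B u, u ≠ u' →
        Disjoint ((B u).erase v) ((B u').erase v) := by
    intro u hu u' hu' huu
    rw [Finset.disjoint_left]
    intro w hw hw'
    rw [Finset.mem_erase] at hw hw'
    exact huu (hB (Finset.mem_filter.mp hu).2 hw.2 (Finset.mem_filter.mp hu').2 hw'.2 hw.1.symm)
  have h := Finset.card_biUnion hdisj
  rw [Finset.sum_congr rfl fun u hu => by
    rw [Finset.card_erase_of_mem (Finset.mem_filter.mp hu).2, hb u]] at h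
  rw [Finset.sum_const, ha, smul_eq_mul] at h
  rw [← h]
  exact Finset.card_le_univ _

/-! ### Binomial estimates and the choice of parameters -/

theorem choose_le_six_mul_div_pow {R s t : ℕ} (ht : 0 < t) (hst : t ≤ 2 * s) :
    (R.choose s : ℝ) ≤ (6 * R / t) ^ s := by
  have hs : (0 : ℝ) < s := by
    exact_mod_cast (by omega : 0 < s)
  have ht' : (0 : ℝ) < t := by exact_mod_cast ht
  have hst' : (t : ℝ) ≤ 2 * s := by exact_mod_cast hst
  have h1 : (s : ℝ) ^ s / s.factorial ≤ 3 ^ s := by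
    calc (s : ℝ) ^ s / s.factorial ≤ Real.exp s := Real.pow_div_factorial_le_exp _ hs.le _
      _ = Real.exp 1 ^ s := by rw [← Real.exp_nat_mul, mul_one]
      _ ≤ 3 ^ s := pow_le_pow_left₀ (Real.exp_pos _).le (by linarith [Real.exp_one_lt_d9]) _
  calc (R.choose s : ℝ) ≤ (R : ℝ) ^ s / s.factorial := Nat.choose_le_pow_div _ _
    _ = (R / s : ℝ) ^ s * ((s : ℝ) ^ s / s.factorial) := by
      rw [div_pow]
      field_simp
    _ ≤ (R / s : ℝ) ^ s * 3 ^ s := by gcongr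
    _ = (3 * R / s : ℝ) ^ s := by
      rw [← mul_pow]
      ring
    _ ≤ (6 * R / t) ^ s := by
      refine pow_le_pow_left₀ (by positivity) ?_ _
      rw [div_le_div_iff₀ hs ht']
      nlinarith [Nat.cast_nonneg (α := ℝ) R]

theorem choose_le_pow_mul_choose {n N t s : ℕ} (hst : s ≤ t) (htn : 2 * t ≤ n) (hn : 0 < n)
    (hN : 2 * N ≤ n) : (N.choose t : ℝ) ≤ (2 * N / n) ^ s * n.choose t := by
  have hn' : (0 : ℝ) < n := by exact_mod_cast hn
  have h1 : (n / 2 : ℝ) ≤ (n + 1 - t : ℕ) := by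
    rw [div_le_iff₀ two_pos]
    exact_mod_cast (by omega : n ≤ (n + 1 - t) * 2)
  calc (N.choose t : ℝ) ≤ (N : ℝ) ^ t / t.factorial := Nat.choose_le_pow_div _ _
    _ = (2 * N / n : ℝ) ^ t * ((n / 2 : ℝ) ^ t / t.factorial) := by
      rw [← mul_div_assoc, ← mul_pow]
      congr 2
      field_simp
    _ ≤ (2 * N / n : ℝ) ^ s * n.choose t := by
      refine mul_le_mul (pow_le_pow_of_le_one (by positivity) ?_ hst)
        (le_trans ?_ (Nat.pow_le_choose t n)) (by positivity) (by positivity)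
      · rw [div_le_one hn']
        exact_mod_cast hN
      · gcongr

/-- All factors are brought to the exponent s = t − r ≥ t/2: C(n,r) ≤ 2^(Kr) ≤ 4^s, and 4 · 6 · 2 =
48. -/
theorem mul_choose_lt_choose {I K N R n r t : ℕ} (hI : I ≤ n.choose r * R.choose (t - r))
    (hn : 0 < n) (hnK : n ≤ 2 ^ K) (hKr : K * r ≤ t) (hr : 2 * r ≤ t) (ht : 0 < t)
    (htn : 2 * t ≤ n) (hN : 2 * N ≤ n) (hR : 48 * (R : ℝ) * N < n * t) :
    I * N.choose t < n.choose t := by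
  have hn' : (0 : ℝ) < n := by exact_mod_cast hn
  have ht' : (0 : ℝ) < t := by exact_mod_cast ht
  obtain ⟨s, hs⟩ : ∃ s, s = t - r := ⟨_, rfl⟩
  rw [← hs] at hI
  have h1 : (n.choose r : ℝ) ≤ 4 ^ s := by
    have : n.choose r ≤ 4 ^ s := by
      calc n.choose r ≤ n ^ r := Nat.choose_le_pow n r
        _ ≤ (2 ^ K) ^ r := Nat.pow_le_pow_left hnK r
        _ = 2 ^ (K * r) := (pow_mul _ _ _).symm
        _ ≤ 2 ^ (2 * s) := Nat.pow_le_pow_right two_pos (by omega)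
        _ = 4 ^ s := by rw [pow_mul]; norm_num
    exact_mod_cast this
  have h2 := choose_le_six_mul_div_pow (R := R) (s := s) ht (by omega)
  have h3 := choose_le_pow_mul_choose (N := N) (s := s) (t := t) (by omega) htn hn hN
  have hC : (0 : ℝ) < n.choose t := by exact_mod_cast Nat.choose_pos (by omega)
  have hI' : (I : ℝ) ≤ n.choose r * R.choose s := by exact_mod_cast hI
  have h : (I : ℝ) * N.choose t < n.choose t := by
    calc (I : ℝ) * N.choose t
        ≤ (4 ^ s * (6 * R / t) ^ s) * ((2 * N / n) ^ s * n.choose t) := by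
          refine mul_le_mul (hI'.trans ?_) h3 (by positivity) (by positivity)
          gcongr
      _ = (48 * R * N / (n * t)) ^ s * n.choose t := by
          rw [← mul_pow, ← mul_assoc, ← mul_pow]
          congr 2
          field_simp
          ring
      _ < 1 * n.choose t := by
          refine mul_lt_mul_of_pos_right (pow_lt_one₀ (by positivity) ?_ (by omega)) hC
          rwa [div_lt_one (by positivity)]
      _ = n.choose t := one_mul _
  exact_mod_cast h

/-- Some random bipartite colouring of the blocks yields a graph with few independent sets. -/
theorem exists_card_indepSetsIn_blockGraph_le {U V : Type*} [Fintype U] [Nonempty U] [Fintype V]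
    [DecidableEq V] {B : U → Finset V} (hB : IsPartialLinearSpace B) {a K : ℕ}
    (ha : ∀ v, (Finset.univ.filter fun u => v ∈ B u).card = a) (hK : 0 < K)
    (hV : Fintype.card V ≤ 2 ^ K) (haK : 16 * K ≤ a) :
    ∃ σ : U → V → Bool, ∀ r t : ℕ, r ≤ t →
      Real.log (Fintype.card V) ≤ (a : ℝ) ^ 2 / (64 * Fintype.card U) * r →
      (indepSetsIn (blockGraph B σ) Finset.univ t).card ≤
        (Fintype.card V).choose r * (16 * Fintype.card U / a + 1).choose (t - r) := by
  obtain ⟨σ, hσ⟩ := exists_coloring_forall_minorityCard ha hK hV haK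
  refine ⟨σ, fun r t hrt hr => ?_⟩
  -- The + 1 compensates for floor division: more than this many points meet the threshold a|X| ≥
  -- 16|U|.
  refine card_indepSetsIn_le (blockGraph B σ) (16 * Fintype.card U / a + 1)
    ((a : ℝ) ^ 2 / (64 * Fintype.card U)) (fun X hX => ?_) Finset.univ r t hrt ?_
  · have h1 : 16 * Fintype.card U ≤ a * X.card :=
      (Nat.lt_mul_div_succ _ (by omega : 0 < a)).le.trans (Nat.mul_le_mul_left _ hX.le)
    exact exists_le_degree_of_le_sum_minorityCard hB σ (Finset.card_pos.mp (Nat.zero_lt_of_lt hX))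
      (by convert hσ X h1)
  · rw [Finset.card_univ]
    have h1 : (1 : ℝ) ≤ (16 * Fintype.card U / a + 1 : ℕ) := by
      exact_mod_cast Nat.le_add_left _ _
    refine le_trans ?_ h1
    rcases Nat.eq_zero_or_pos (Fintype.card V) with h0 | h0
    · simp [h0]
    · have h0' : (0 : ℝ) < Fintype.card V := by exact_mod_cast h0
      calc (Fintype.card V : ℝ) * Real.exp (-((a : ℝ) ^ 2 / (64 * Fintype.card U) * r))
          ≤ Fintype.card V * Real.exp (-Real.log (Fintype.card V)) := by gcongr
        _ = 1 := by rw [Real.exp_neg, Real.exp_log h0', mul_inv_cancel₀ h0'.ne']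

theorem clog_le_logb_add_one {n : ℕ} (hn : 2 ≤ n) :
    (Nat.clog 2 n : ℝ) ≤ Real.logb 2 n + 1 := by
  have h1 : 2 ^ (Nat.clog 2 n).pred < n := Nat.pow_pred_clog_lt_self one_lt_two (by omega)
  have h2 : ((Nat.clog 2 n).pred : ℝ) ≤ Real.logb 2 n := by
    rw [Real.le_logb_iff_rpow_le (by norm_num) (by positivity), Real.rpow_natCast]
    exact_mod_cast h1.le
  have h3 : (Nat.clog 2 n : ℝ) ≤ (Nat.clog 2 n).pred + 1 := by
    exact_mod_cast (by rw [Nat.pred_eq_sub_one]; omega : Nat.clog 2 n ≤ (Nat.clog 2 n).pred + 1)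
  linarith

theorem log_natCast_le_logb_two (n : ℕ) : Real.log n ≤ Real.logb 2 n := by
  rw [Real.logb, le_div_iff₀ (Real.log_pos one_lt_two)]
  have h0 : 0 ≤ Real.log n := Real.log_natCast_nonneg n
  nlinarith [Real.log_two_lt_d9]

theorem mul_eight_mul_le {a b n t t₀ L : ℝ} (ha : 0 < a) (hb : 0 < b) (hL : 0 < L)
    (haL : 2 ^ 12 * L ^ 3 ≤ a) (ht : 0 < t) (ht₀ : t₀ * (a * b) = 256 * n * L ^ 2)
    (htt : t ≤ 2 * t₀) : b * t * (8 * L) ≤ n := by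
  have h1 : b * t * a ≤ 512 * n * L ^ 2 := by
    calc b * t * a = t * (a * b) := by ring
      _ ≤ 2 * t₀ * (a * b) := by gcongr
      _ = 512 * n * L ^ 2 := by linear_combination 2 * ht₀
  have h2 : b * t * (2 ^ 12 * L ^ 3) ≤ 512 * n * L ^ 2 :=
    (mul_le_mul_of_nonneg_left haL (by positivity)).trans h1
  have h3 : (b * t * (8 * L)) * (512 * L ^ 2) ≤ n * (512 * L ^ 2) := by linarith
  exact le_of_mul_le_mul_right h3 (by positivity)

/-- The density is ab/(64n), and r ≈ t/L ≈ 256nL/(ab), so the product is about 4L; the spare factor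
absorbs the roundings of t, r and K. -/
theorem le_density_mul {a b m n L K r t t₀ : ℝ} (ha : 0 < a) (hb : 0 < b) (hm : 0 < m) (hn : 0 < n)
    (hL : 12 ≤ L) (hmb : b * m = a * n) (hab : a * b ≤ 2 * n)
    (ht₀ : t₀ * (a * b) = 256 * n * L ^ 2) (hr : 0 ≤ r) (hK : K ≤ L + 1)
    (htK : t ≤ K * (r + 1)) (ht : t₀ - 1 ≤ t) : L ≤ a ^ 2 / (64 * m) * r := by
  have h2 : a ^ 2 / (64 * m) = a * b / (64 * n) := by
    rw [div_eq_div_iff (by positivity) (by positivity)]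
    linear_combination (-64 * a) * hmb
  rw [h2, div_mul_eq_mul_div, le_div_iff₀ (by positivity)]
  have h3 : t₀ - 1 ≤ (L + 1) * (r + 1) :=
    ht.trans (htK.trans (mul_le_mul_of_nonneg_right hK (by positivity)))
  have h4 : (t₀ - 1) * (a * b) ≤ (L + 1) * (r + 1) * (a * b) := by gcongr
  have h5 : (L + 2) * (a * b) ≤ (L + 2) * (2 * n) := by gcongr
  have h6 : L * (64 * n) * (L + 1) ≤ a * b * r * (L + 1) := by
    have h7 : L * 64 * (L + 1) + (L + 2) * 2 ≤ 256 * L ^ 2 := by nlinarith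
    have h8 := mul_le_mul_of_nonneg_right h7 hn.le
    linarith
  exact le_of_mul_le_mul_right h6 (by positivity)

theorem mul_mul_lt_mul {b n t L N R : ℝ} (hn : 0 < n) (ht : 0 < t) (hL : 12 ≤ L) (hR : 0 ≤ R)
    (hN : N * (1000 * L) < b * t) (hRb : R * b ≤ 17 * n) : 48 * R * N < n * t := by
  have h1 : 48 * R * (N * (1000 * L)) ≤ 48 * R * (b * t) := by gcongr
  have h2 : 48 * (R * b) * t ≤ 48 * (17 * n) * t := by gcongr
  have h3 : n * t * (1000 * 12) ≤ n * t * (1000 * L) := by gcongr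
  have h4 : 0 < n * t := by positivity
  have h5 : 48 * R * N * (1000 * L) < n * t * (1000 * L) := by linarith
  exact lt_of_mul_lt_mul_right h5 (by positivity)

theorem theorem1 :
    ∃ c : ℝ, 0 < c ∧
      ∀ (W : Type*) [Finite W] (F : SimpleGraph W) (a b m n t : ℕ),
        0 < a → 0 < b → 0 < m → 2 ≤ n →
        2 ^ 12 * Real.logb 2 (n : ℝ) ^ 3 ≤ (a : ℝ) →
        (∃ G : SimpleGraph (Fin m ⊕ Fin n), IsMNABGraph m n a b G ∧ IsLFree F G) →
        |(t : ℝ) - 2 ^ 8 * (n : ℝ) * Real.logb 2 (n : ℝ) ^ 2 / ((a : ℝ) * (b : ℝ))| < 1 →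
        c * ((b : ℝ) * (t : ℝ) / Real.logb 2 (n : ℝ)) ≤ (ramseyNumber F t : ℝ) := by
  refine ⟨1 / 1000, by norm_num, ?_⟩
  intro W _ F a b m n t ha hb hm hn haL ⟨G, hG, hF⟩ ht
  have hlin := isPartialLinearSpace_block hF.1
  have hcb := card_block hG
  have hca := card_filter_mem_block hG
  have : NeZero m := ⟨hm.ne'⟩
  have : NeZero n := ⟨by omega⟩
  have hmb : b * m = a * n := by
    have h := sum_card_inter_block hca Finset.univ
    simp_rw [Finset.univ_inter, hcb] at h
    simpa [mul_comm] using h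
  have ham : a ≤ m := by
    rw [← hca 0]
    exact (Finset.card_le_univ _).trans (by simp)
  have han : a ≤ n := ham.trans hG.m_le_n
  have hbn : b ≤ n := by
    rw [← hcb 0]
    exact (Finset.card_le_univ _).trans (by simp)
  have habn : a * b ≤ 2 * n := by
    have h := mul_pred_card_block_le hlin hcb 0 (hca 0)
    rw [Fintype.card_fin] at h
    obtain ⟨b', rfl⟩ : ∃ b', b = b' + 1 := ⟨b - 1, by omega⟩
    rw [Nat.add_sub_cancel] at h
    rw [Nat.mul_succ]
    omega
  set L := Real.logb 2 (n : ℝ) with hL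
  have hL1 : 1 ≤ L := by
    rw [hL, Real.le_logb_iff_rpow_le (by norm_num) (by positivity)]
    norm_num
    exact_mod_cast hn
  have ha12 : (2 : ℝ) ^ 12 ≤ a := by nlinarith [one_le_pow₀ hL1 (n := 3)]
  have hL12 : 12 ≤ L := by
    -- Here n ≥ a ≥ 2^12.
    rw [hL, Real.le_logb_iff_rpow_le (by norm_num) (by positivity)]
    have : (a : ℝ) ≤ n := by exact_mod_cast han
    norm_num at ha12 ⊢
    linarith
  have hlogL : Real.log n ≤ L := log_natCast_le_logb_two n
  set K := Nat.clog 2 n with hK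
  have hnK : n ≤ 2 ^ K := Nat.le_pow_clog one_lt_two n
  have hKL : (K : ℝ) ≤ L + 1 := clog_le_logb_add_one hn
  have hK2 : 2 ≤ K := by
    by_contra! hlt
    have h1 : 2 ^ K ≤ 2 ^ 1 := Nat.pow_le_pow_right two_pos (by omega)
    have h2 : 2 ^ 12 ≤ a := by exact_mod_cast ha12
    omega
  have hL3 : L ≤ L ^ 3 := le_self_pow₀ hL1 (by norm_num)
  have haK : 16 * K ≤ a := by
    have : (16 * K : ℝ) ≤ a := by linarith
    exact_mod_cast this
  have haR : (0 : ℝ) < a := by exact_mod_cast ha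
  have hbR : (0 : ℝ) < b := by exact_mod_cast hb
  have hmR : (0 : ℝ) < m := by exact_mod_cast hm
  have hnR : (0 : ℝ) < n := by positivity
  have hmbR : (b : ℝ) * m = a * n := by exact_mod_cast hmb
  have habnR : (a : ℝ) * b ≤ 2 * n := by exact_mod_cast habn
  set t₀ : ℝ := 2 ^ 8 * (n : ℝ) * L ^ 2 / ((a : ℝ) * (b : ℝ)) with ht₀
  have ht₀eq : t₀ * (a * b) = 256 * n * L ^ 2 := by
    rw [ht₀]
    field_simp
    norm_num
  obtain ⟨htl, htu⟩ := abs_lt.mp ht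
  have ht₀L : 128 * L ^ 2 ≤ t₀ := by
    rw [ht₀, le_div_iff₀ (by positivity)]
    nlinarith [sq_nonneg L]
  have hL2 : 144 ≤ L ^ 2 := by nlinarith
  have htpos : 0 < t := by
    have : (0 : ℝ) < t := by linarith
    exact_mod_cast this
  have htR : (0 : ℝ) < t := by exact_mod_cast htpos
  have hbt : (b : ℝ) * t * (8 * L) ≤ n :=
    mul_eight_mul_le haR hbR (by linarith) haL htR ht₀eq (by linarith)
  have htn : 2 * t ≤ n := by
    have h1 : (1 : ℝ) ≤ b := by exact_mod_cast hb
    have : (2 * t : ℝ) ≤ n := by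
      refine le_trans ?_ hbt
      have h2 : (1 : ℝ) * t * (8 * 12) ≤ b * t * (8 * L) := by gcongr
      linarith
    exact_mod_cast this
  have hr : Real.log n ≤ (a : ℝ) ^ 2 / (64 * m) * (t / K : ℕ) := by
    have h1 : (t : ℝ) ≤ K * ((t / K : ℕ) + 1) := by
      exact_mod_cast (Nat.lt_mul_div_succ t (by omega : 0 < K)).le
    exact hlogL.trans (le_density_mul haR hbR hmR hnR hL12 hmbR habnR ht₀eq (Nat.cast_nonneg _) hKL
      h1 (by linarith))
  have hKr : K * (t / K) ≤ t := Nat.mul_div_le t K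
  have h2r : 2 * (t / K) ≤ t := (Nat.mul_le_mul_right _ hK2).trans hKr
  -- Sampling is applied with N equal to the Ramsey number itself, which yields N < N.
  by_contra! hlt
  set N := ramseyNumber F t with hN
  have hNR : (N : ℝ) * (1000 * L) < b * t := by
    rw [one_div, inv_mul_eq_div, div_div, lt_div_iff₀ (by positivity)] at hlt
    linarith
  have hNn : 2 * N ≤ n := by
    have : (2 * N : ℝ) ≤ n := by
      refine le_trans ?_ hbt
      have : (N : ℝ) * (1000 * 12) ≤ N * (1000 * L) := by gcongr
      have : (b : ℝ) * t * 1 ≤ b * t * (8 * L) := by gcongr; linarith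
      linarith [Nat.cast_nonneg (α := ℝ) N]
    exact_mod_cast this
  have hRb : ((16 * m / a + 1 : ℕ) : ℝ) * b ≤ 17 * n := by
    have h1 : ((16 * m / a : ℕ) : ℝ) ≤ 16 * m / a := by
      simpa using Nat.cast_div_le (α := ℝ) (m := 16 * m) (n := a)
    have h2 : (16 * m / a : ℝ) * b = 16 * n := by
      rw [div_mul_eq_mul_div, div_eq_iff haR.ne']
      linear_combination 16 * hmbR
    have h3 : (b : ℝ) ≤ n := by exact_mod_cast hbn
    push_cast
    nlinarith
  have hRN : 48 * ((16 * m / a + 1 : ℕ) : ℝ) * N < n * t :=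
    mul_mul_lt_mul hnR htR hL12 (Nat.cast_nonneg _) hNR hRb
  obtain ⟨σ, hσ⟩ := exists_card_indepSetsIn_blockGraph_le hlin hca (by omega : 0 < K)
    (by simpa using hnK) haK
  have hI := hσ (t / K) t (by omega) (by simpa using hr)
  rw [Fintype.card_fin, Fintype.card_fin] at hI
  have hfew := mul_choose_lt_choose hI (by omega) hnK hKr h2r htpos htn hNn hRN
  exact lt_irrefl _ (lt_ramseyNumber (free_blockGraph_block hF σ) (by omega) hfew)
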